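/- For an even integer $k>0$ let $$ \mathrm{M}_{-3}(k)=\sqrt{2\pi}\,i^{-k}\,L\Big(\tfrac12,\chi_{-3}\Big)\Big(\frac{2}{\sqrt3}\Big)^{k-\frac12}F\Big(\frac{k-\frac12}{2},\frac{k-\frac12}{2};\frac12;-\frac13\Big)\frac{\Gamma\big(\frac{k-1/2}{2}\big)}{\Gamma\big(\frac{k+1/2}{2}\big)}, $$ where $\chi_{-3}=\big(\frac{-3}{\cdot}\big)$ is the Kronecker symbol, $L(s,\chi_{-3})$ is its (analytically continued) Dirichlet $L$-function, and $F(a,b;c;z)$ is the Gauss hypergeometric function. Then, as $k\to\infty$ through even integers, $$ \mathrm{M}_{-3}(k)=3^{\frac14}\sqrt{2\pi}\,L\Big(\tfrac12,\chi_{-3}\Big)\frac{\Gamma(k-\frac12)}{\Gamma(k)}\big[S(k)+O(k^{-1})\big], $$ where $S(k)=-1$, $0$ or $1$ according as $k\equiv 2$, $4$ or $0\pmod 6$. Moreover $\mathrm{M}_{-3}(k)$ is of exact order $k^{-1/2}$ as $k\to\infty$ through even integers $k\not\equiv4\pmod 6$ (that is, there are constants $0<c<C$ with $c\,k^{-1/2}\le|\mathrm{M}_{-3}(k)|\le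 C\,k^{-1/2}$ for all sufficiently large such $k$), and $\mathrm{M}_{-3}(k)=O(k^{-3/2})$ as $k\to\infty$ through integers $k\equiv4\pmod 6$. -/

import Mathlib

open Filter Asymptotics

/-- The Kronecker symbol `(D / n)` for a natural number `n`: it is multiplicative in `n`, agrees
with the Jacobi symbol for odd `n`, and `(D / 2)` is `0` for even `D`, `1` for `D ≡ ±1 (mod 8)`
and `-1` for `D ≡ ±3 (mod 8)`; moreover `(D / 0)` is `1` if `D = ±1` and `0` otherwise. -/
def kroneckerSymbol (D : ℤ) (n : ℕ) : ℤ :=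
  if n = 0 then (if D.natAbs = 1 then 1 else 0)
  else (if D % 2 = 0 then 0 else if D % 8 = 1 ∨ D % 8 = 7 then 1 else -1) ^ (padicValNat 2 n) *
    jacobiSym D (n / 2 ^ padicValNat 2 n)

/-- The Dirichlet character `χ_{-3}` modulo `3`, i.e. the Kronecker symbol `(-3 / ·)`
(see `chiNegThree_natCast`), realised as the quadratic character of `ℤ/3ℤ`. -/
noncomputable def chiNegThree : DirichletCharacter ℂ 3 :=
  haveI : Fact (Nat.Prime 3) := ⟨Nat.prime_three⟩
  (quadraticChar (ZMod 3)).ringHomComp (Int.castRingHom ℂ)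

theorem jacobiSym_neg_three_of_odd {m : ℕ} (hm : Odd m) :
    jacobiSym (-3) m = jacobiSym m 3 := by
  have h3 : Odd 3 := by decide
  have h1 : jacobiSym (-3) m = ZMod.χ₄ m * jacobiSym (3 : ℕ) m := by
    rw [show (-3 : ℤ) = -((3 : ℕ) : ℤ) by norm_num, jacobiSym.neg _ hm]
  rcases Nat.odd_mod_four_iff.mp (Nat.odd_iff.mp hm) with h | h
  · rw [h1, ZMod.χ₄_nat_one_mod_four h, one_mul,
      jacobiSym.quadratic_reciprocity_one_mod_four' h3 h]
  · rw [h1, ZMod.χ₄_nat_three_mod_four h,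
      jacobiSym.quadratic_reciprocity_three_mod_four (by norm_num) h]
    ring

/-- `χ_{-3}` is the Kronecker symbol `(-3 / ·)`. -/
theorem chiNegThree_natCast (n : ℕ) :
    chiNegThree (n : ZMod 3) = (kroneckerSymbol (-3) n : ℂ) := by
  have : Fact (Nat.Prime 3) := ⟨Nat.prime_three⟩
  have h0 : chiNegThree (n : ZMod 3) = ((jacobiSym n 3 : ℤ) : ℂ) := by
    rw [← jacobiSym.legendreSym.to_jacobiSym]
    simp [chiNegThree, legendreSym, MulChar.ringHomComp_apply]
  rw [h0]
  congr 1
  unfold kroneckerSymbol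
  split_ifs with hn h h' h''
  · simp at h
  · subst hn; norm_num [jacobiSym.zero_left]
  · simp at h'
  · simp at h''
  · obtain ⟨v, m, hm, rfl⟩ := Nat.exists_eq_two_pow_mul_odd hn
    have hm0 : m ≠ 0 := by rintro rfl; simp at hm
    have hv : padicValNat 2 (2 ^ v * m) = v := by
      rw [padicValNat.mul (by positivity) hm0, padicValNat.prime_pow,
        padicValNat.eq_zero_of_not_dvd (by rwa [← even_iff_two_dvd, Nat.not_even_iff_odd]),
        add_zero]
    rw [hv, Nat.mul_div_cancel_left _ (by positivity), jacobiSym_neg_three_of_odd hm]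
    push_cast
    rw [jacobiSym.mul_left, jacobiSym.pow_left]
    congr 2
    norm_num

/-- The secondary main term `M_{-3}` of weight `k`:
`√(2π) i^{-k} L(1/2, χ_{-3}) (2/√3)^{k-1/2} F((k-1/2)/2, (k-1/2)/2; 1/2; -1/3)
  Γ((k-1/2)/2) / Γ((k+1/2)/2)`. -/
noncomputable def secondaryTermNegThree (k : ℕ) : ℂ :=
  (Real.sqrt (2 * Real.pi) : ℂ) * Complex.I ^ (-(k : ℤ)) * chiNegThree.LFunction (1 / 2) *
    (((2 / Real.sqrt 3) ^ ((k : ℝ) - 1 / 2) : ℝ) : ℂ) *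
    ((₂F₁ (((k : ℝ) - 1 / 2) / 2) (((k : ℝ) - 1 / 2) / 2) (1 / 2 : ℝ) (-(1 / 3) : ℝ) : ℝ) : ℂ) *
    ((Real.Gamma (((k : ℝ) - 1 / 2) / 2) / Real.Gamma (((k : ℝ) + 1 / 2) / 2) : ℝ) : ℂ)

/-- `S(k)`, for even `k`: it is `-1`, `0`, `1` according as `k ≡ 2, 4, 0 (mod 6)`. -/
def residueSign (k : ℕ) : ℤ :=
  if k % 6 = 2 then -1 else if k % 6 = 4 then 0 else 1

/-! Put `m = k - 1` and `a = (m + 1/2) / 2`. The substitution `z = -tan² t` together with the factor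
`cos⁻ᵐ t` removes the first-order term from the hypergeometric equation of `F(a, a; 1/2; z)`: `v(t)
= cos⁻ᵐ t · F(a, a; 1/2; -tan² t)` satisfies `v'' = -(m² + sec² t / 4) v`, `v(0) = 1`, `v'(0) = 0`.
The argument `-1/3` is `t = π/6`, and on `[0, π/6]` the perturbation `sec² t / 4` is bounded
independently of `m`. Hence `v(π/6) = cos(mπ/6) + O(1/m)`
(`abs_liouvilleHypergeometric_sub_cos_le`).

As `1 / cos(π/6) = 2/√3`, the factor `cos⁻ᵐ` absorbs the power in `M₋₃`, and `i⁻ᵏ cos((k-1)π/6) =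
S(k) √3/2`. Log-convexity of `Γ` replaces the given Gamma quotient by `√2 Γ(k-1/2)/Γ(k)` with
relative error `O(1/k)`, and shows that `Γ(k-1/2)/Γ(k)` has exact order `k^(-1/2)`. The lower bound
also needs `L(1/2, χ₋₃) ≠ 0`; pairing consecutive terms of the Dirichlet series gives a sum of
positive numbers. -/

/-! ### The hypergeometric series and its differential equation -/

theorem FormalMultilinearSeries.hasSum_deriv_of_hasFPowerSeriesOnBall {f : ℝ → ℝ}
    {p : FormalMultilinearSeries ℝ ℝ ℝ} {r : ENNReal} (h : HasFPowerSeriesOnBall f p 0 r)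
    {z : ℝ} (hz : z ∈ Metric.eball (0 : ℝ) r) :
    HasSum (fun n : ℕ => ((n : ℝ) + 1) * p.coeff (n + 1) * z ^ n) (deriv f z) := by
  have h1 := (h.fderiv.hasSum hz).mapL (ContinuousLinearMap.apply ℝ ℝ (1 : ℝ))
  simp only [ContinuousLinearMap.apply_apply, zero_add, fderiv_apply_one_eq_deriv] at h1
  refine h1.congr_fun ?_
  intro n
  rw [FormalMultilinearSeries.apply_eq_pow_smul_coeff]
  simp only [FunLike.coe_smul, Pi.smul_apply, FormalMultilinearSeries.derivSeries_coeff_one,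
    smul_eq_mul, nsmul_eq_mul]
  push_cast
  ring

theorem eval_ascPochhammer_succ_eq_mul (n : ℕ) (x : ℝ) :
    (ascPochhammer ℝ (n + 1)).eval x = x * (ascPochhammer ℝ n).eval (x + 1) := by
  simp [ascPochhammer_succ_left, Polynomial.eval_comp]

theorem ordinaryHypergeometricCoefficient_succ_eq_shift {a b c : ℝ} (n : ℕ) :
    ((n : ℝ) + 1) * ordinaryHypergeometricCoefficient a b c (n + 1) =
      a * b / c * ordinaryHypergeometricCoefficient (a + 1) (b + 1) (c + 1) n := by
  have h : ((n.factorial : ℝ)) ≠ 0 := by positivity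
  have h' : (n : ℝ) + 1 ≠ 0 := by positivity
  simp only [ordinaryHypergeometricCoefficient, eval_ascPochhammer_succ_eq_mul,
    Nat.factorial_succ, mul_inv, Nat.cast_mul, Nat.cast_succ]
  field_simp

theorem ordinaryHypergeometricCoefficient_succ {a b c : ℝ} (hc : 0 < c) (n : ℕ) :
    ((n : ℝ) + 1) * (n + c) * ordinaryHypergeometricCoefficient a b c (n + 1) =
      (n + a) * (n + b) * ordinaryHypergeometricCoefficient a b c n := by
  have h : ((n.factorial : ℝ)) ≠ 0 := by positivity
  have h' : (n : ℝ) + 1 ≠ 0 := by positivity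
  have h2 : c + n ≠ 0 := by positivity
  have h3 : (ascPochhammer ℝ n).eval c ≠ 0 := (ascPochhammer_pos n c hc).ne'
  simp only [ordinaryHypergeometricCoefficient, ascPochhammer_succ_eval,
    Nat.factorial_succ, mul_inv, Nat.cast_mul, Nat.cast_succ]
  field_simp
  ring

theorem hasFPowerSeriesOnBall_ordinaryHypergeometric {a b c : ℝ} (ha : 0 < a) (hb : 0 < b)
    (hc : 0 < c) :
    HasFPowerSeriesOnBall (₂F₁ a b c : ℝ → ℝ) (ordinaryHypergeometricSeries ℝ a b c) 0 1 := by
  have h1 : (ordinaryHypergeometricSeries ℝ a b c).radius = 1 :=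
    ordinaryHypergeometricSeries_radius_eq_one ℝ a b c fun n => by
      have : (0 : ℝ) ≤ n := n.cast_nonneg
      exact ⟨by linarith, by linarith, by linarith⟩
  have h := (ordinaryHypergeometricSeries ℝ a b c).hasFPowerSeriesOnBall (by simp [h1])
  rwa [h1] at h

theorem mem_eball_one_of_abs_lt {z : ℝ} (hz : |z| < 1) : z ∈ Metric.eball (0 : ℝ) 1 := by
  rw [← ENNReal.ofReal_one, Metric.eball_ofReal]
  simpa using hz

theorem hasSum_ordinaryHypergeometric {a b c : ℝ} (ha : 0 < a) (hb : 0 < b) (hc : 0 < c)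
    {z : ℝ} (hz : |z| < 1) :
    HasSum (fun n => ordinaryHypergeometricCoefficient a b c n * z ^ n) (₂F₁ a b c z) := by
  have h := (hasFPowerSeriesOnBall_ordinaryHypergeometric ha hb hc).hasSum
    (mem_eball_one_of_abs_lt hz)
  simpa only [ordinaryHypergeometricSeries_apply_eq, smul_eq_mul, zero_add] using h

theorem hasDerivAt_ordinaryHypergeometric {a b c : ℝ} (ha : 0 < a) (hb : 0 < b) (hc : 0 < c)
    {z : ℝ} (hz : |z| < 1) :
    HasDerivAt (₂F₁ a b c : ℝ → ℝ) (a * b / c * ₂F₁ (a + 1) (b + 1) (c + 1) z) z := by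
  have hF := hasFPowerSeriesOnBall_ordinaryHypergeometric ha hb hc
  have hz' := mem_eball_one_of_abs_lt hz
  have h1 := FormalMultilinearSeries.hasSum_deriv_of_hasFPowerSeriesOnBall hF hz'
  have h2 := (hasSum_ordinaryHypergeometric (a := a + 1) (b := b + 1) (c := c + 1)
    (by positivity) (by positivity) (by positivity) hz).mul_left (a * b / c)
  have h3 : deriv (₂F₁ a b c : ℝ → ℝ) z = a * b / c * ₂F₁ (a + 1) (b + 1) (c + 1) z := by
    refine h1.unique (h2.congr_fun fun n => ?_)
    rw [ordinaryHypergeometricSeries, FormalMultilinearSeries.coeff_ofScalars,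
      ordinaryHypergeometricCoefficient_succ_eq_shift]
    ring
  rw [← h3]
  exact ((hF.analyticAt_of_mem hz').differentiableAt).hasDerivAt

/-- The hypergeometric differential equation. -/
theorem ordinaryHypergeometric_ode {a b c : ℝ} (ha : 0 < a) (hb : 0 < b) (hc : 0 < c)
    {z : ℝ} (hz : |z| < 1) :
    z * (1 - z) * (a * b / c * ((a + 1) * (b + 1) / (c + 1) *
        ₂F₁ (a + 1 + 1) (b + 1 + 1) (c + 1 + 1) z)) +
      (c - (a + b + 1) * z) * (a * b / c * ₂F₁ (a + 1) (b + 1) (c + 1) z) -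
      a * b * ₂F₁ a b c z = 0 := by
  set C := ordinaryHypergeometricCoefficient a b c with hC
  have h0 := hasSum_ordinaryHypergeometric ha hb hc hz
  have h1 : HasSum (fun n : ℕ => ((n : ℝ) + 1) * C (n + 1) * z ^ n)
      (a * b / c * ₂F₁ (a + 1) (b + 1) (c + 1) z) := by
    refine ((hasSum_ordinaryHypergeometric (a := a + 1) (b := b + 1) (c := c + 1)
      (by positivity) (by positivity) (by positivity) hz).mul_left (a * b / c)).congr_fun
      fun n => ?_
    rw [hC, ordinaryHypergeometricCoefficient_succ_eq_shift]
    ring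
  have h2 : HasSum (fun n : ℕ => ((n : ℝ) + 1) * (n + 2) * C (n + 2) * z ^ n)
      (a * b / c * ((a + 1) * (b + 1) / (c + 1) *
        ₂F₁ (a + 1 + 1) (b + 1 + 1) (c + 1 + 1) z)) := by
    refine (((hasSum_ordinaryHypergeometric (a := a + 1 + 1) (b := b + 1 + 1) (c := c + 1 + 1)
      (by positivity) (by positivity) (by positivity) hz).mul_left
      ((a + 1) * (b + 1) / (c + 1))).mul_left (a * b / c)).congr_fun fun n => ?_
    have e1 := ordinaryHypergeometricCoefficient_succ_eq_shift (a := a) (b := b) (c := c) (n + 1)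
    have e2 := ordinaryHypergeometricCoefficient_succ_eq_shift
      (a := a + 1) (b := b + 1) (c := c + 1) n
    rw [← mul_assoc ((a + 1) * (b + 1) / (c + 1)), ← e2]
    push_cast at e1
    rw [show a * b / c * (((n : ℝ) + 1) *
        ordinaryHypergeometricCoefficient (a + 1) (b + 1) (c + 1) (n + 1) * z ^ n) =
        ((n : ℝ) + 1) * (a * b / c *
        ordinaryHypergeometricCoefficient (a + 1) (b + 1) (c + 1) (n + 1)) * z ^ n by ring, ← e1]
    ring
  have shift : ∀ {u : ℕ → ℝ} {s : ℝ}, HasSum (fun n => u (n + 1) * z ^ n) s →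
      u 0 = 0 → HasSum (fun n => u n * z ^ n) (z * s) := by
    intro u s hs h
    rw [← hasSum_nat_add_iff' 1]
    simp only [Finset.range_one, Finset.sum_singleton, h, zero_mul, sub_zero]
    exact (hs.mul_left z).congr_fun fun n => by ring
  -- `k1`, `k2`, `k3` expand `zF'`, `zF''`, `z²F''`. In the equation the coefficient of `zⁿ` becomes
  -- `(n+1)(n+c) C (n+1) - (n+a)(n+b) C n`, which vanishes by the recurrence.
  have k1 := shift (u := fun n => (n : ℝ) * C n) (by simpa using h1) (by simp)
  have k2 := shift (u := fun n => (n : ℝ) * (n + 1) * C (n + 1))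
    (h2.congr_fun fun n => by push_cast; ring) (by simp)
  have k3 := shift (u := fun n => (n : ℝ) * (n - 1) * C n)
    (k2.congr_fun fun n => by push_cast; ring) (by simp)
  have := (((k2.sub k3).add (h1.mul_left c)).sub (k1.mul_left (a + b + 1))).sub
    (h0.mul_left (a * b))
  have hzero := (this.congr_fun (g := fun _ => 0) fun n => ?_).unique hasSum_zero
  · rw [← hzero]; ring
  · have := ordinaryHypergeometricCoefficient_succ (a := a) (b := b) hc n
    rw [← hC] at this ⊢
    linear_combination -z ^ n * this

/-! ### Gamma quotients by log-convexity -/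

theorem Real.Gamma_midpoint_sq_le {s t : ℝ} (hs : 0 < s) (ht : 0 < t) :
    Real.Gamma ((s + t) / 2) ^ 2 ≤ Real.Gamma s * Real.Gamma t := by
  have h := Real.Gamma_mul_add_mul_le_rpow_Gamma_mul_rpow_Gamma hs ht
    (show (0 : ℝ) < 1 / 2 by norm_num) (show (0 : ℝ) < 1 / 2 by norm_num) (by norm_num)
  rw [show 1 / 2 * s + 1 / 2 * t = (s + t) / 2 by ring, ← Real.sqrt_eq_rpow,
    ← Real.sqrt_eq_rpow] at h
  have h0 : 0 < Real.Gamma ((s + t) / 2) := Real.Gamma_pos_of_pos (by positivity)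
  calc _ ≤ (√(Real.Gamma s) * √(Real.Gamma t)) ^ 2 := by gcongr
    _ = _ := by
      rw [mul_pow, Real.sq_sqrt (Real.Gamma_pos_of_pos hs).le,
        Real.sq_sqrt (Real.Gamma_pos_of_pos ht).le]

/-- Log-convexity at the midpoint of `x` and `x + 1`; the companion upper bound uses the midpoint of
`x - 1/2` and `x + 1/2`. -/
theorem Real.inv_le_Gamma_div_Gamma_add_half_sq {x : ℝ} (hx : 0 < x) :
    x⁻¹ ≤ (Real.Gamma x / Real.Gamma (x + 1 / 2)) ^ 2 := by
  have h := Real.Gamma_midpoint_sq_le hx (show 0 < x + 1 by positivity)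
  have h0 : 0 < Real.Gamma (x + 1 / 2) := Real.Gamma_pos_of_pos (by positivity)
  rw [Real.Gamma_add_one hx.ne', show (x + (x + 1)) / 2 = x + 1 / 2 by ring] at h
  rw [div_pow, inv_eq_one_div, div_le_div_iff₀ hx (by positivity)]
  linarith

theorem Real.Gamma_div_Gamma_add_half_sq_le {x : ℝ} (hx : 1 / 2 < x) :
    (Real.Gamma x / Real.Gamma (x + 1 / 2)) ^ 2 ≤ (x - 1 / 2)⁻¹ := by
  have hx' : 0 < x - 1 / 2 := by linarith
  have h := Real.Gamma_midpoint_sq_le hx' (show 0 < x + 1 / 2 by positivity)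
  have h0 : 0 < Real.Gamma (x + 1 / 2) := Real.Gamma_pos_of_pos (by positivity)
  have h1 := Real.Gamma_add_one hx'.ne'
  rw [show x - 1 / 2 + 1 = x + 1 / 2 by ring] at h1
  rw [show (x - 1 / 2 + (x + 1 / 2)) / 2 = x by ring] at h
  rw [div_pow, inv_eq_one_div, div_le_div_iff₀ (by positivity) hx']
  calc _ ≤ Real.Gamma (x - 1 / 2) * Real.Gamma (x + 1 / 2) * (x - 1 / 2) := by gcongr
    _ = _ := by linear_combination -Real.Gamma (x + 1 / 2) * h1

/-! ### Nonvanishing of `L(1/2, χ₋₃)` -/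

theorem chiNegThree_zero : chiNegThree 0 = 0 := by
  have h := chiNegThree_natCast 0
  simpa [kroneckerSymbol] using h

theorem chiNegThree_two : chiNegThree 2 = -1 := by
  have h := chiNegThree_natCast 2
  rw [kroneckerSymbol, padicValNat_self] at h
  norm_num at h
  exact h

/-- The difference of consecutive terms of the Dirichlet series of `χ_{-3}`. -/
noncomputable def chiNegThreePair (n : ℕ) (s : ℂ) : ℂ :=
  ((3 * n + 1 : ℝ) : ℂ) ^ (-s) - ((3 * n + 2 : ℝ) : ℂ) ^ (-s)

/-- Mean value inequality for `x ↦ x^(-s)` on an interval of length one. The gained power of `x`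
makes the paired series converge absolutely beyond `s = 1/2`. -/
theorem norm_chiNegThreePair_le (n : ℕ) {s : ℂ} (hs : 1 / 4 < s.re) :
    ‖chiNegThreePair n s‖ ≤ ‖s‖ * ((n : ℝ) + 1) ^ (-(5 / 4) : ℝ) := by
  have hder : ∀ x ∈ Set.Icc (3 * (n : ℝ) + 1) (3 * n + 2),
      HasDerivWithinAt (fun x : ℝ => (x : ℂ) ^ (-s)) (-s * (x : ℂ) ^ (-s - 1))
        (Set.Icc (3 * (n : ℝ) + 1) (3 * n + 2)) x := by
    intro x hx
    have hx0 : 0 < x := by have := hx.1; have : (0 : ℝ) ≤ n := n.cast_nonneg; linarith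
    have h := ((hasDerivAt_id (x : ℂ)).cpow_const (c := -s) (by simp [hx0])).comp_ofReal
    simpa using h.hasDerivWithinAt
  have hb : ∀ x ∈ Set.Icc (3 * (n : ℝ) + 1) (3 * n + 2),
      ‖-s * (x : ℂ) ^ (-s - 1)‖ ≤ ‖s‖ * ((n : ℝ) + 1) ^ (-(5 / 4) : ℝ) := by
    intro x hx
    have hn : (0 : ℝ) ≤ n := n.cast_nonneg
    have hx1 : (n : ℝ) + 1 ≤ x := by have := hx.1; linarith
    rw [norm_mul, norm_neg, Complex.norm_cpow_eq_rpow_re_of_pos (by linarith)]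
    gcongr
    calc x ^ (-s - 1).re ≤ x ^ (-(5 / 4) : ℝ) := by
          apply Real.rpow_le_rpow_of_exponent_le (by linarith)
          simp; linarith
      _ ≤ _ := Real.rpow_le_rpow_of_nonpos (by positivity) hx1 (by norm_num)
  have h := (convex_Icc (3 * (n : ℝ) + 1) (3 * n + 2)).norm_image_sub_le_of_norm_hasDerivWithin_le
    hder hb (Set.right_mem_Icc.2 (by linarith)) (Set.left_mem_Icc.2 (by linarith))
  refine h.trans_eq ?_
  rw [show 3 * (n : ℝ) + 1 - (3 * n + 2) = -1 by ring]
  simp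

theorem summable_add_one_rpow_neg : Summable fun n : ℕ => ((n : ℝ) + 1) ^ (-(5 / 4) : ℝ) := by
  have h : Summable fun n : ℕ => (n : ℝ) ^ (-(5 / 4) : ℝ) :=
    Real.summable_nat_rpow.2 (by norm_num)
  simpa using (summable_nat_add_iff 1).2 h

theorem LFunction_chiNegThree_eq_tsum_of_one_lt_re {s : ℂ} (hs : 1 < s.re) :
    chiNegThree.LFunction s = ∑' n, chiNegThreePair n s := by
  rw [DirichletCharacter.LFunction_eq_LSeries _ hs]
  have hsum : LSeriesSummable (fun n : ℕ => chiNegThree n) s :=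
    DirichletCharacter.LSeriesSummable_of_one_lt_re _ hs
  have hinj : ∀ j : ℕ, Function.Injective fun m : ℕ => j + 3 * m := fun j a b h => by
    simpa using h
  have h1 := hsum.comp_injective (hinj 1)
  have h2 := hsum.comp_injective (hinj 2)
  have e3 : ((3 : ℕ) : ZMod 3) = 0 := rfl
  rw [LSeries, Nat.sumByResidueClasses hsum 3]
  rw [show (Finset.univ : Finset (ZMod 3)) = {0, 1, 2} from rfl]
  rw [Finset.sum_insert (by decide), Finset.sum_insert (by decide), Finset.sum_singleton]
  rw [show (0 : ZMod 3).val = 0 from rfl, show (1 : ZMod 3).val = 1 from rfl,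
    show (2 : ZMod 3).val = 2 from rfl]
  have t0 : ∀ m : ℕ, LSeries.term (fun n : ℕ => chiNegThree n) s (0 + 3 * m) = 0 := fun m => by
    rw [LSeries.term_def]
    simp only [Nat.cast_add, Nat.cast_mul, e3]
    simp [chiNegThree_zero]
  have e3' : (3 : ZMod 3) = 0 := rfl
  have t1 : ∀ m : ℕ, LSeries.term (fun n : ℕ => chiNegThree n) s (1 + 3 * m) =
      ((3 * m + 1 : ℝ) : ℂ) ^ (-s) := fun m => by
    rw [LSeries.term_of_ne_zero (by omega), Complex.cpow_neg]
    push_cast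
    simp [e3', add_comm]
  have t2 : ∀ m : ℕ, LSeries.term (fun n : ℕ => chiNegThree n) s (2 + 3 * m) =
      -((3 * m + 2 : ℝ) : ℂ) ^ (-s) := fun m => by
    rw [LSeries.term_of_ne_zero (by omega), Complex.cpow_neg]
    push_cast
    simp [e3', chiNegThree_two, add_comm, neg_div]
  rw [tsum_congr t0, tsum_zero, zero_add]
  refine (Summable.tsum_add h1 h2).symm.trans ?_
  refine tsum_congr fun m => ?_
  rw [Function.comp_apply, Function.comp_apply, t1, t2, chiNegThreePair]
  ring

theorem chiNegThree_ne_one : chiNegThree ≠ 1 := by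
  intro h
  have h2 := chiNegThree_two
  rw [h, MulChar.one_apply (by decide)] at h2
  norm_num at h2

/-- `L(1/2, χ_{-3})` is the sum of the conditionally convergent Dirichlet series. -/
theorem LFunction_chiNegThree_half_eq_tsum :
    chiNegThree.LFunction (1 / 2) = ∑' n, chiNegThreePair n (1 / 2) := by
  -- A convex domain for the identity theorem containing both `1/2` and `2`; near `2` the Dirichlet
  -- series converges absolutely. The ball bounds `‖s‖`, giving a uniform majorant.
  let U : Set ℂ := {s | 1 / 4 < s.re} ∩ Metric.ball 0 3
  have hUo : IsOpen U := (isOpen_lt continuous_const Complex.continuous_re).inter Metric.isOpen_ball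
  have hUc : Convex ℝ U := (convex_halfSpace_re_gt _).inter (convex_ball _ _)
  have hd : DifferentiableOn ℂ (fun s => ∑' n, chiNegThreePair n s) U := by
    refine Complex.differentiableOn_tsum_of_summable_norm
      (u := fun n : ℕ => 3 * ((n : ℝ) + 1) ^ (-(5 / 4) : ℝ))
      (summable_add_one_rpow_neg.mul_left 3) (fun n => ?_) hUo fun n s hs => ?_
    · intro s _
      have e : ∀ x : ℝ, 0 < x → DifferentiableAt ℂ (fun s : ℂ => (x : ℂ) ^ (-s)) s := fun x hx =>
        differentiableAt_id.neg.const_cpow (Or.inl (by exact_mod_cast hx.ne'))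
      exact ((e _ (by positivity)).sub (e _ (by positivity))).differentiableWithinAt
    · refine (norm_chiNegThreePair_le n hs.1).trans ?_
      have : ‖s‖ < 3 := by simpa using hs.2
      gcongr
  have hL : AnalyticOnNhd ℂ chiNegThree.LFunction U :=
    (DirichletCharacter.differentiable_LFunction chiNegThree_ne_one).differentiableOn.analyticOnNhd
      hUo
  have h2 : (2 : ℂ) ∈ U := ⟨by norm_num, by norm_num [Metric.mem_ball]⟩
  refine hL.eqOn_of_preconnected_of_eventuallyEq (hd.analyticOnNhd hUo) hUc.isPreconnected h2 ?_
    ⟨by norm_num, by norm_num [Metric.mem_ball]⟩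
  have : {s : ℂ | 1 < s.re} ∈ nhds (2 : ℂ) :=
    (isOpen_lt continuous_const Complex.continuous_re).mem_nhds (by norm_num)
  filter_upwards [this] with s hs
  exact LFunction_chiNegThree_eq_tsum_of_one_lt_re hs

/-- Every paired term is real and positive, because `x^(-1/2)` decreases. -/
theorem LFunction_chiNegThree_half_ne_zero : chiNegThree.LFunction (1 / 2) ≠ 0 := by
  let d : ℕ → ℝ := fun n => (3 * n + 1 : ℝ) ^ (-(1 / 2) : ℝ) - (3 * n + 2 : ℝ) ^ (-(1 / 2) : ℝ)
  have hd : ∀ n, chiNegThreePair n (1 / 2) = (d n : ℂ) := fun n => by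
    simp only [chiNegThreePair, d]
    rw [Complex.ofReal_sub, Complex.ofReal_cpow (by positivity), Complex.ofReal_cpow (by positivity)]
    norm_num
  have hpos : ∀ n, 0 < d n := fun n =>
    sub_pos.2 (Real.rpow_lt_rpow_of_neg (by positivity) (by linarith) (by norm_num))
  have hs : Summable d := by
    refine Summable.of_norm_bounded
      (g := fun n : ℕ => ‖(1 / 2 : ℂ)‖ * ((n : ℝ) + 1) ^ (-(5 / 4) : ℝ))
      (summable_add_one_rpow_neg.mul_left _) fun n => ?_
    rw [← Complex.norm_real, ← hd]
    exact norm_chiNegThreePair_le n (by norm_num)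
  rw [LFunction_chiNegThree_half_eq_tsum, tsum_congr hd, ← Complex.ofReal_tsum]
  exact_mod_cast (hs.tsum_pos (fun n => (hpos n).le) 0 (hpos 0)).ne'

/-! ### Perturbation of the harmonic oscillator -/

/-- The energy estimate for `v'' = -(l² + q) v` with `|q| ≤ 1`, on an interval of length at most
one. -/
theorem energy_le_of_hasDerivAt {v w q : ℝ → ℝ} {T l : ℝ} (hl : 1 ≤ l) (hT : T ≤ 1)
    (hv : ∀ t ∈ Set.Icc 0 T, HasDerivAt v (w t) t)
    (hw : ∀ t ∈ Set.Icc 0 T, HasDerivAt w (-(l ^ 2 + q t) * v t) t)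
    (hq : ∀ t ∈ Set.Icc 0 T, |q t| ≤ 1) (hv0 : v 0 = 1) (hw0 : w 0 = 0) :
    ∀ t ∈ Set.Icc 0 T, l ^ 2 * v t ^ 2 + w t ^ 2 ≤ 3 * l ^ 2 := by
  -- The energy `E = l²v² + w²` has derivative `-2qvw`, at most `E` since `|q| ≤ 1 ≤ l`. So `E e⁻ᵗ`
  -- decreases from `l²`, and `e ≤ 3` gives the constant.
  have hd : ∀ t ∈ Set.Icc 0 T,
      HasDerivAt (fun t => (l ^ 2 * v t ^ 2 + w t ^ 2) * Real.exp (-t))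
        ((-2 * q t * v t * w t - (l ^ 2 * v t ^ 2 + w t ^ 2)) * Real.exp (-t)) t := by
    intro t ht
    have h1 := ((((hv t ht).pow 2).const_mul (l ^ 2)).add ((hw t ht).pow 2)).mul
      (hasDerivAt_neg t).exp
    refine h1.congr_deriv ?_
    simp only [Pi.add_apply, Pi.pow_apply]
    push_cast
    ring
  have hanti : AntitoneOn (fun t => (l ^ 2 * v t ^ 2 + w t ^ 2) * Real.exp (-t))
      (Set.Icc 0 T) := by
    refine antitoneOn_of_deriv_nonpos (convex_Icc _ _)
      (fun t ht => (hd t ht).continuousAt.continuousWithinAt)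
      (fun t ht => (hd t (interior_subset ht)).differentiableAt.differentiableWithinAt)
      fun t ht => ?_
    have ht' := interior_subset ht
    rw [(hd t ht').deriv]
    refine mul_nonpos_of_nonpos_of_nonneg ?_ (Real.exp_pos _).le
    have h2 : |-2 * q t * v t * w t| ≤ 2 * |v t| * |w t| := by
      have : |-2 * q t * v t * w t| = |q t| * (2 * |v t| * |w t|) := by
        simp only [abs_mul, abs_neg, abs_two]; ring
      rw [this]
      exact mul_le_of_le_one_left (by positivity) (hq t ht')
    have h3 : 2 * |v t| * |w t| ≤ l ^ 2 * v t ^ 2 + w t ^ 2 := by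
      have h4 : v t ^ 2 ≤ l ^ 2 * v t ^ 2 :=
        le_mul_of_one_le_left (sq_nonneg _) (one_le_pow₀ hl)
      have h5 := sq_nonneg (|v t| - |w t|)
      rw [sub_sq, sq_abs, sq_abs] at h5
      linarith
    linarith [le_abs_self (-2 * q t * v t * w t)]
  intro t ht
  have h := hanti (Set.left_mem_Icc.2 (ht.1.trans ht.2)) ht ht.1
  simp only [hv0, hw0, neg_zero, Real.exp_zero] at h
  rw [Real.exp_neg, ← div_eq_mul_inv, div_le_iff₀ (Real.exp_pos _)] at h
  have he : Real.exp t ≤ 3 :=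
    (Real.exp_le_exp.2 (ht.2.trans hT)).trans (Real.exp_one_lt_d9.le.trans (by norm_num))
  nlinarith [sq_nonneg l]

theorem abs_sub_cos_le_of_hasDerivAt {v w q : ℝ → ℝ} {T l : ℝ} (hl : 1 ≤ l) (hT0 : 0 ≤ T)
    (hT : T ≤ 1) (hv : ∀ t ∈ Set.Icc 0 T, HasDerivAt v (w t) t)
    (hw : ∀ t ∈ Set.Icc 0 T, HasDerivAt w (-(l ^ 2 + q t) * v t) t)
    (hq : ∀ t ∈ Set.Icc 0 T, |q t| ≤ 1) (hv0 : v 0 = 1) (hw0 : w 0 = 0) :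
    |v T - Real.cos (l * T)| ≤ 2 / l := by
  have hl0 : 0 < l := by linarith
  -- Duhamel's device: `P t` is the value at time `T` of the unperturbed solution with data `(v t, w
  -- t)` at time `t`. Its derivative involves only `q`, and it runs from `cos (l * T)` to `v T`.
  let P : ℝ → ℝ := fun t =>
    v t * Real.cos (l * (T - t)) + w t / l * Real.sin (l * (T - t))
  have hd : ∀ t ∈ Set.Icc 0 T,
      HasDerivWithinAt P (-(q t * v t * Real.sin (l * (T - t)) / l)) (Set.Icc 0 T) t := by
    intro t ht
    have h0 : HasDerivAt (fun t => l * (T - t)) (-l) t := by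
      simpa using ((hasDerivAt_id t).const_sub T).const_mul l
    have h1 := ((hv t ht).mul h0.cos).add (((hw t ht).div_const l).mul h0.sin)
    refine (h1.congr_deriv ?_).hasDerivWithinAt
    field_simp
    ring
  have hb : ∀ t ∈ Set.Icc 0 T, ‖-(q t * v t * Real.sin (l * (T - t)) / l)‖ ≤ 2 / l := by
    intro t ht
    have he := energy_le_of_hasDerivAt hl hT hv hw hq hv0 hw0 t ht
    have hv2 : |v t| ≤ 2 := by
      refine abs_le_of_sq_le_sq ?_ (by norm_num)
      have : l ^ 2 * v t ^ 2 ≤ l ^ 2 * 3 := by linarith [sq_nonneg (w t)]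
      linarith [le_of_mul_le_mul_left this (by positivity)]
    rw [norm_neg, norm_div, norm_mul, norm_mul]
    simp only [Real.norm_eq_abs, abs_of_pos hl0]
    gcongr
    calc |q t| * |v t| * |Real.sin (l * (T - t))| ≤ 1 * 2 * 1 := by
          gcongr
          · exact hq t ht
          · exact Real.abs_sin_le_one _
      _ = 2 := by norm_num
  have h := (convex_Icc 0 T).norm_image_sub_le_of_norm_hasDerivWithin_le hd hb
    (Set.left_mem_Icc.2 hT0) (Set.right_mem_Icc.2 hT0)
  have hPT : P T = v T := by simp [P]
  have hP0 : P 0 = Real.cos (l * T) := by simp [P, hv0, hw0]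
  rw [hPT, hP0, sub_zero, Real.norm_eq_abs, Real.norm_of_nonneg hT0] at h
  exact h.trans (mul_le_of_le_one_right (by positivity) hT)

/-! ### The Liouville transform -/

theorem tan_mem_Icc_of_mem_Icc {t : ℝ} (ht : t ∈ Set.Icc 0 (Real.pi / 6)) :
    0 ≤ Real.tan t ∧ Real.tan t ^ 2 ≤ 1 / 3 ∧ 0 < Real.cos t := by
  have hpi := Real.pi_pos
  have h0 : 0 ≤ Real.tan t := Real.tan_nonneg_of_nonneg_of_le_pi_div_two ht.1 (by linarith [ht.2])
  have h1 : Real.tan t ≤ Real.tan (Real.pi / 6) :=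
    Real.strictMonoOn_tan.monotoneOn ⟨by linarith [ht.1], by linarith [ht.2]⟩
      ⟨by linarith, by linarith⟩ ht.2
  rw [Real.tan_pi_div_six] at h1
  refine ⟨h0, ?_, Real.cos_pos_of_mem_Ioo ⟨by linarith [ht.1], by linarith [ht.2]⟩⟩
  calc Real.tan t ^ 2 ≤ (1 / √3) ^ 2 := by gcongr
    _ = 1 / 3 := by rw [div_pow, Real.sq_sqrt (by norm_num)]; norm_num

/-- The Liouville transform of the hypergeometric function `F(a, a; 1/2; ·)`,
`a = (m + 1/2) / 2`. -/
noncomputable def liouvilleHypergeometric (m : ℕ) (t : ℝ) : ℝ :=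
  (Real.cos t)⁻¹ ^ m *
    ₂F₁ (((m : ℝ) + 1 / 2) / 2) (((m : ℝ) + 1 / 2) / 2) (1 / 2 : ℝ) (-(Real.tan t ^ 2))

theorem hasDerivAt_inv_cos {t : ℝ} (ht : Real.cos t ≠ 0) :
    HasDerivAt (fun t => (Real.cos t)⁻¹) ((Real.cos t)⁻¹ * Real.tan t) t := by
  refine ((Real.hasDerivAt_cos t).inv ht).congr_deriv ?_
  rw [Real.tan_eq_sin_div_cos]
  field_simp

theorem hasDerivAt_tan_one_add_sq {t : ℝ} (ht : Real.cos t ≠ 0) :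
    HasDerivAt Real.tan (1 + Real.tan t ^ 2) t := by
  refine (Real.hasDerivAt_tan ht).congr_deriv ?_
  rw [Real.tan_eq_sin_div_cos]
  field_simp
  linarith [Real.sin_sq_add_cos_sq t]

theorem abs_liouvilleHypergeometric_sub_cos_le {m : ℕ} (hm : 1 ≤ m) :
    |liouvilleHypergeometric m (Real.pi / 6) - Real.cos (m * (Real.pi / 6))| ≤ 2 / m := by
  set a : ℝ := ((m : ℝ) + 1 / 2) / 2 with ha
  have ha0 : 0 < a := by positivity
  let g : ℝ → ℝ := ₂F₁ a a (1 / 2 : ℝ)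
  let g1 : ℝ → ℝ := fun z => a * a / (1 / 2) * ₂F₁ (a + 1) (a + 1) (1 / 2 + 1 : ℝ) z
  let g2 : ℝ → ℝ := fun z => a * a / (1 / 2) * ((a + 1) * (a + 1) / (1 / 2 + 1) *
    ₂F₁ (a + 1 + 1) (a + 1 + 1) (1 / 2 + 1 + 1 : ℝ) z)
  have hg : ∀ z, |z| < 1 → HasDerivAt g (g1 z) z := fun z hz =>
    hasDerivAt_ordinaryHypergeometric ha0 ha0 (by norm_num) hz
  have hg1 : ∀ z, |z| < 1 → HasDerivAt g1 (g2 z) z := fun z hz =>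
    (hasDerivAt_ordinaryHypergeometric (by positivity) (by positivity) (by norm_num) hz).const_mul _
  have hode : ∀ z, |z| < 1 → z * (1 - z) * g2 z + (1 / 2 - (a + a + 1) * z) * g1 z -
      a * a * g z = 0 := fun z hz => ordinaryHypergeometric_ode ha0 ha0 (by norm_num) hz
  -- The derivative of the Liouville transform, with the power of `1 / cos` factored out.
  let w : ℝ → ℝ := fun t => (Real.cos t)⁻¹ ^ m * (m * Real.tan t * g (-(Real.tan t ^ 2)) +
    (1 + Real.tan t ^ 2) * (-2 * Real.tan t * g1 (-(Real.tan t ^ 2))))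
  have key : ∀ t ∈ Set.Icc 0 (Real.pi / 6), |-(Real.tan t ^ 2)| < 1 ∧ Real.cos t ≠ 0 ∧
      HasDerivAt (fun t => -(Real.tan t ^ 2)) (-2 * Real.tan t * (1 + Real.tan t ^ 2)) t ∧
      HasDerivAt (fun t => (Real.cos t)⁻¹ ^ m) (m * ((Real.cos t)⁻¹ ^ m * Real.tan t)) t := by
    intro t ht
    obtain ⟨h0, h1, h2⟩ := tan_mem_Icc_of_mem_Icc ht
    refine ⟨?_, h2.ne', ?_, ?_⟩
    · rw [abs_neg, abs_of_nonneg (sq_nonneg _)]; linarith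
    · refine ((hasDerivAt_tan_one_add_sq h2.ne').pow 2).neg.congr_deriv ?_
      push_cast; ring
    · refine ((hasDerivAt_inv_cos h2.ne').pow m).congr_deriv ?_
      obtain ⟨n, rfl⟩ := Nat.exists_eq_add_of_le' hm
      rw [Nat.add_sub_cancel, pow_succ]
      ring
  have hv : ∀ t ∈ Set.Icc 0 (Real.pi / 6), HasDerivAt (liouvilleHypergeometric m) (w t) t := by
    intro t ht
    obtain ⟨h1, h2, h3, h4⟩ := key t ht
    have h5 := h4.mul ((hg _ h1).comp t h3)
    refine HasDerivAt.congr_deriv (f := liouvilleHypergeometric m) h5 ?_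
    simp only [w, Function.comp_apply]
    ring
  have hw : ∀ t ∈ Set.Icc 0 (Real.pi / 6), HasDerivAt w
      (-((m : ℝ) ^ 2 + (1 + Real.tan t ^ 2) / 4) * liouvilleHypergeometric m t) t := by
    intro t ht
    obtain ⟨h1, h2, h3, h4⟩ := key t ht
    have h5 := hasDerivAt_tan_one_add_sq h2
    have h6 := (h5.const_mul (m : ℝ)).mul ((hg _ h1).comp t h3)
    have h7 := ((h5.pow 2).const_add 1).mul ((h5.const_mul (-2)).mul ((hg1 _ h1).comp t h3))
    refine (h4.mul (h6.add h7)).congr_deriv ?_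
    have hz := hode _ h1
    have hL : liouvilleHypergeometric m t =
      (Real.cos t)⁻¹ ^ m * g (-(Real.tan t ^ 2)) := rfl
    rw [hL]
    simp only [Pi.add_apply, Pi.mul_apply, Pi.pow_apply, Function.comp_apply]
    have hma : (m : ℝ) = 2 * a - 1 / 2 := by rw [ha]; ring
    rw [hma]
    push_cast
    -- With `z = -tan² t` one has `(dz/dt)² = -4 (1 + tan² t) z (1 - z)`, whence the multiplier.
    linear_combination (-4 * (Real.cos t)⁻¹ ^ m * (1 + Real.tan t ^ 2)) * hz
  refine abs_sub_cos_le_of_hasDerivAt (w := w) (q := fun t => (1 + Real.tan t ^ 2) / 4)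
    (by exact_mod_cast hm) (by positivity) (by linarith [Real.pi_lt_four]) hv hw ?_ ?_ ?_
  · intro t ht
    have := (tan_mem_Icc_of_mem_Icc ht).2.1
    rw [abs_of_nonneg (by positivity)]
    linarith
  · simp [liouvilleHypergeometric]
  · simp [w]

/-! ### The sign `S(k)` and the comparison of Gamma quotients -/

/-- Absorbing the sign as a shift by `jπ` turns the angle into `4jπ/3 - π/6`, which modulo `2π`
depends only on `j` modulo `3`. -/
theorem neg_one_pow_mul_cos_eq_residueSign (j : ℕ) :
    (-1) ^ j * Real.cos ((2 * (j : ℝ) - 1) * (Real.pi / 6)) =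
      residueSign (2 * j) * (√3 / 2) := by
  rw [← Real.cos_add_nat_mul_pi]
  obtain ⟨i, r, hr, rfl⟩ : ∃ i r : ℕ, r < 3 ∧ j = r + 3 * i :=
    ⟨j / 3, j % 3, Nat.mod_lt _ (by norm_num), (Nat.mod_add_div j 3).symm⟩
  have h : (2 * ((r + 3 * i : ℕ) : ℝ) - 1) * (Real.pi / 6) + ((r + 3 * i : ℕ) : ℝ) * Real.pi =
      (4 * r * (Real.pi / 3) - Real.pi / 6) + ((2 * i : ℕ) : ℝ) * (2 * Real.pi) := by
    push_cast; ring
  rw [h, Real.cos_add_nat_mul_two_pi, residueSign]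
  have h2 : 2 * (r + 3 * i) % 6 = 2 * r % 6 := by omega
  rw [h2]
  interval_cases r
  · norm_num
  · rw [show 4 * ((1 : ℕ) : ℝ) * (Real.pi / 3) - Real.pi / 6 = Real.pi / 6 + Real.pi by
      push_cast; ring, Real.cos_add_pi]
    norm_num
  · rw [show 4 * ((2 : ℕ) : ℝ) * (Real.pi / 3) - Real.pi / 6 = Real.pi / 2 + 2 * Real.pi by
      push_cast; ring, Real.cos_add_two_pi]
    norm_num

theorem Complex.I_zpow_neg_two_mul (j : ℕ) : Complex.I ^ (-((2 * j : ℕ) : ℤ)) = (-1) ^ j := by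
  rw [zpow_neg, zpow_natCast, pow_mul, Complex.I_sq, ← inv_pow]
  norm_num

/-- The ratio `Γ(x) / Γ(x + 1/2)`. -/
noncomputable def gammaHalfRatio (x : ℝ) : ℝ := Real.Gamma x / Real.Gamma (x + 1 / 2)

theorem gammaHalfRatio_pos {x : ℝ} (hx : 0 < x) : 0 < gammaHalfRatio x :=
  div_pos (Real.Gamma_pos_of_pos hx) (Real.Gamma_pos_of_pos (by positivity))

theorem abs_sub_one_le_abs_sq_sub_one {x : ℝ} (hx : 0 ≤ x) : |x - 1| ≤ |x ^ 2 - 1| := by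
  rw [show x ^ 2 - 1 = (x - 1) * (x + 1) by ring, abs_mul, abs_of_nonneg (by positivity : 0 ≤ x + 1)]
  exact le_mul_of_one_le_right (abs_nonneg _) (by linarith)

/-- The log-convexity bounds place the square between `1 - 1/(2k-1)` and `1 + 2/(2k-3)`; for the
latter, `4/k` suffices exactly when `k ≥ 2`. -/
theorem abs_gammaHalfRatio_div_sq_sub_one_le {k : ℝ} (hk : 2 ≤ k) :
    |(gammaHalfRatio ((k - 1 / 2) / 2) / (√2 * gammaHalfRatio (k - 1 / 2))) ^ 2 - 1| ≤ 4 / k := by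
  have l1 := Real.inv_le_Gamma_div_Gamma_add_half_sq (x := (k - 1 / 2) / 2) (by linarith)
  have u1 := Real.Gamma_div_Gamma_add_half_sq_le (x := (k - 1 / 2) / 2) (by linarith)
  have l2 := Real.inv_le_Gamma_div_Gamma_add_half_sq (x := k - 1 / 2) (by linarith)
  have u2 := Real.Gamma_div_Gamma_add_half_sq_le (x := k - 1 / 2) (by linarith)
  change _ ≤ gammaHalfRatio _ ^ 2 at l1
  change _ ≤ gammaHalfRatio _ ^ 2 at l2
  change gammaHalfRatio _ ^ 2 ≤ _ at u1
  change gammaHalfRatio _ ^ 2 ≤ _ at u2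
  have p2 := gammaHalfRatio_pos (x := k - 1 / 2) (by linarith)
  rw [div_pow, mul_pow, Real.sq_sqrt (by norm_num), abs_le]
  generalize gammaHalfRatio ((k - 1 / 2) / 2) ^ 2 = x at *
  have p3 : 0 < gammaHalfRatio (k - 1 / 2) ^ 2 := by positivity
  generalize gammaHalfRatio (k - 1 / 2) ^ 2 = y at *
  have a1 : 0 < k - 1 / 2 := by linarith
  have a2 : 0 < k - 1 := by linarith
  constructor
  · have : 1 - 4 / k ≤ x / (2 * y) := by
      calc 1 - 4 / k ≤ ((k - 1 / 2) / 2)⁻¹ / (2 * (k - 1 / 2 - 1 / 2)⁻¹) := by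
            rw [show k - 1 / 2 - 1 / 2 = k - 1 by ring]
            rw [show ((k - 1 / 2) / 2)⁻¹ / (2 * (k - 1)⁻¹) = 1 - 1 / (2 * k - 1) by
              have : 2 * k - 1 ≠ 0 := by linarith
              rw [show k - 1 / 2 = (2 * k - 1) / 2 by ring]
              field_simp; ring]
            rw [sub_le_sub_iff_left, div_le_div_iff₀ (by linarith) (by linarith)]
            linarith
        _ ≤ x / (2 * y) := by
            have : 0 ≤ x := (inv_nonneg.2 (by linarith)).trans l1
            gcongr
    linarith
  · have : x / (2 * y) ≤ 1 + 4 / k := by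
      calc x / (2 * y) ≤ ((k - 1 / 2) / 2 - 1 / 2)⁻¹ / (2 * (k - 1 / 2)⁻¹) := by
            have : 0 ≤ ((k - 1 / 2) / 2 - 1 / 2)⁻¹ := inv_nonneg.2 (by linarith)
            gcongr
        _ = 1 + 2 / (2 * k - 3) := by
            have : 2 * k - 3 ≠ 0 := by linarith
            rw [show (k - 1 / 2) / 2 - 1 / 2 = (2 * k - 3) / 4 by ring,
              show k - 1 / 2 = (2 * k - 1) / 2 by ring]
            have : 2 * k - 1 ≠ 0 := by linarith
            field_simp; ring
        _ ≤ 1 + 4 / k := by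
            gcongr 1 + ?_
            rw [div_le_div_iff₀ (by linarith) (by linarith)]
            linarith
    linarith

/-! ### The asymptotic formula and its consequences -/

theorem secondaryTermNegThree_eq_liouvilleHypergeometric (j : ℕ) (hj : 0 < j) :
    secondaryTermNegThree (2 * j) = (√(2 * Real.pi) : ℂ) * chiNegThree.LFunction (1 / 2) *
      (((-1) ^ j * (2 / √3) ^ (1 / 2 : ℝ) * liouvilleHypergeometric (2 * j - 1) (Real.pi / 6) *
        gammaHalfRatio ((((2 * j : ℕ) : ℝ) - 1 / 2) / 2) : ℝ) : ℂ) := by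
  have hm : ((2 * j - 1 : ℕ) : ℝ) + 1 / 2 = ((2 * j : ℕ) : ℝ) - 1 / 2 := by
    rw [Nat.cast_sub (by omega)]; push_cast; ring
  have hp : (2 / √3 : ℝ) ^ (((2 * j : ℕ) : ℝ) - 1 / 2) =
      (2 / √3) ^ (1 / 2 : ℝ) * (2 / √3) ^ (2 * j - 1) := by
    rw [← hm, Real.rpow_add (by positivity), Real.rpow_natCast, mul_comm]
  have ht : Real.tan (Real.pi / 6) ^ 2 = 1 / 3 := by
    rw [Real.tan_pi_div_six, div_pow, Real.sq_sqrt (by norm_num)]; norm_num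
  rw [secondaryTermNegThree, Complex.I_zpow_neg_two_mul, hp, liouvilleHypergeometric, hm, ht,
    Real.cos_pi_div_six, inv_div, gammaHalfRatio,
    show (((2 * j : ℕ) : ℝ) - 1 / 2) / 2 + 1 / 2 = (((2 * j : ℕ) : ℝ) + 1 / 2) / 2 by ring]
  push_cast
  ring

/-- Source of the constant `3^(1/4)`: the `√2` comes from the Gamma comparison, and the remaining
`2/√3` cancels the `√3/2` of the cosine. -/
theorem two_div_sqrt_three_rpow_half :
    (2 / √3 : ℝ) ^ (1 / 2 : ℝ) * √2 = 3 ^ (1 / 4 : ℝ) * (2 / √3) := by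
  have h3 : (3 : ℝ) ^ (1 / 4 : ℝ) * 3 ^ (1 / 4 : ℝ) = √3 := by
    rw [← Real.rpow_add (by norm_num), Real.sqrt_eq_rpow]; norm_num
  have h4 : (√3 : ℝ) ^ (1 / 2 : ℝ) = 3 ^ (1 / 4 : ℝ) := by
    rw [Real.sqrt_eq_rpow, ← Real.rpow_mul (by norm_num)]; norm_num
  have h0 : (0 : ℝ) < 3 ^ (1 / 4 : ℝ) := by positivity
  rw [Real.div_rpow (by norm_num) (by positivity), h4, ← Real.sqrt_eq_rpow, ← h3]
  field_simp
  exact Real.sq_sqrt (by norm_num)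

/-- The relative error in the asymptotic formula for `secondaryTermNegThree`. -/
noncomputable def secondaryTermError (k : ℕ) : ℝ :=
  (-1) ^ (k / 2) * (2 / √3) * liouvilleHypergeometric (k - 1) (Real.pi / 6) *
    (gammaHalfRatio (((k : ℝ) - 1 / 2) / 2) / (√2 * gammaHalfRatio ((k : ℝ) - 1 / 2))) -
    residueSign k

theorem abs_residueSign_le_one (k : ℕ) : |(residueSign k : ℝ)| ≤ 1 := by
  unfold residueSign
  split_ifs <;> norm_num

theorem abs_secondaryTermError_le {k : ℕ} (hk0 : 0 < k) (hk : Even k) :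
    |secondaryTermError k| ≤ 20 / k := by
  obtain ⟨j, rfl⟩ := hk.exists_two_nsmul
  rw [smul_eq_mul] at *
  have hj : 1 ≤ j := by omega
  have hj' : (1 : ℝ) ≤ j := by exact_mod_cast hj
  have hk2 : (2 : ℝ) ≤ ((2 * j : ℕ) : ℝ) := by push_cast; linarith
  have hm1 : ((2 * j - 1 : ℕ) : ℝ) = 2 * j - 1 := by
    rw [Nat.cast_sub (by omega)]; push_cast; ring
  rw [secondaryTermError, Nat.mul_div_cancel_left _ (by norm_num)]
  have hρ := abs_gammaHalfRatio_div_sq_sub_one_le hk2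
  have hρ0 : 0 ≤ gammaHalfRatio ((((2 * j : ℕ) : ℝ) - 1 / 2) / 2) /
      (√2 * gammaHalfRatio (((2 * j : ℕ) : ℝ) - 1 / 2)) :=
    div_nonneg (gammaHalfRatio_pos (by linarith)).le
      (mul_nonneg (Real.sqrt_nonneg _) (gammaHalfRatio_pos (by linarith)).le)
  generalize gammaHalfRatio ((((2 * j : ℕ) : ℝ) - 1 / 2) / 2) /
      (√2 * gammaHalfRatio (((2 * j : ℕ) : ℝ) - 1 / 2)) = ρ at *
  have hρ1 := (abs_sub_one_le_abs_sq_sub_one hρ0).trans hρ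
  have hV := abs_liouvilleHypergeometric_sub_cos_le (m := 2 * j - 1) (by omega)
  rw [hm1] at hV
  have hcos := neg_one_pow_mul_cos_eq_residueSign j
  generalize Real.cos ((2 * (j : ℝ) - 1) * (Real.pi / 6)) = c at *
  generalize liouvilleHypergeometric (2 * j - 1) (Real.pi / 6) = V at *
  have hS := abs_residueSign_le_one (2 * j)
  generalize (residueSign (2 * j) : ℝ) = S at *
  have h3 : (1 : ℝ) ≤ √3 := Real.one_le_sqrt.2 (by norm_num)
  -- The oscillator error `V - c` and the Gamma error `ρ - 1` separate; with `ρ ≤ 2` they contribute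
  -- `16/k` and `4/k`.
  have hid : (-1) ^ j * (2 / √3) * V * ρ - S =
      (-1) ^ j * (2 / √3) * (V - c) * ρ + S * (ρ - 1) := by
    have : S = (2 / √3) * ((-1) ^ j * c) := by rw [hcos]; field_simp
    linear_combination (-ρ) * this
  have hk4 : (4 : ℝ) / ((2 * j : ℕ) : ℝ) ≤ 2 := by
    rw [div_le_iff₀ (by linarith)]; linarith
  have hρ3 : ρ ≤ 2 := by
    have h1 := (abs_le.1 hρ).2
    nlinarith
  have hV' : |V - c| ≤ 4 / ((2 * j : ℕ) : ℝ) := by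
    refine hV.trans ?_
    push_cast
    rw [div_le_div_iff₀ (by linarith) (by linarith)]
    linarith
  rw [hid]
  calc _ ≤ |(-1) ^ j * (2 / √3) * (V - c) * ρ| + |S * (ρ - 1)| := abs_add_le _ _
    _ = 2 / √3 * |V - c| * ρ + |S| * |ρ - 1| := by
      rw [abs_mul, abs_mul, abs_mul, abs_mul, abs_pow, abs_neg, abs_one, one_pow, one_mul,
        abs_of_nonneg hρ0, abs_of_pos (by positivity : (0 : ℝ) < 2 / √3)]
    _ ≤ 2 * (4 / ((2 * j : ℕ) : ℝ)) * 2 + 1 * (4 / ((2 * j : ℕ) : ℝ)) := by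
      gcongr
      exact div_le_self (by norm_num) h3
    _ = 20 / ((2 * j : ℕ) : ℝ) := by ring

theorem secondaryTermNegThree_eq {k : ℕ} (hk0 : 0 < k) (hk : Even k) :
    secondaryTermNegThree k = (((3 : ℝ) ^ (1 / 4 : ℝ) * √(2 * Real.pi) : ℝ) : ℂ) *
      chiNegThree.LFunction (1 / 2) * (gammaHalfRatio ((k : ℝ) - 1 / 2) : ℂ) *
      ((residueSign k : ℂ) + (secondaryTermError k : ℂ)) := by
  obtain ⟨j, rfl⟩ := hk.exists_two_nsmul
  rw [smul_eq_mul] at *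
  have hj : 1 ≤ j := by omega
  have hj' : (1 : ℝ) ≤ j := by exact_mod_cast hj
  have hp : gammaHalfRatio (((2 * j : ℕ) : ℝ) - 1 / 2) ≠ 0 :=
    (gammaHalfRatio_pos (by push_cast; linarith)).ne'
  rw [secondaryTermNegThree_eq_liouvilleHypergeometric j (by omega), secondaryTermError,
    Nat.mul_div_cancel_left _ (by norm_num)]
  have h : ∀ V r : ℝ, (-1) ^ j * (2 / √3) ^ (1 / 2 : ℝ) * V * r = 3 ^ (1 / 4 : ℝ) *
      gammaHalfRatio (((2 * j : ℕ) : ℝ) - 1 / 2) * ((-1) ^ j * (2 / √3) * V *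
        (r / (√2 * gammaHalfRatio (((2 * j : ℕ) : ℝ) - 1 / 2)))) := by
    intro V r
    have h2 : (2 / √3 : ℝ) ^ (1 / 2 : ℝ) = 3 ^ (1 / 4 : ℝ) * (2 / √3) / √2 := by
      rw [eq_div_iff (by positivity), two_div_sqrt_three_rpow_half]
    rw [h2]
    generalize gammaHalfRatio (((2 * j : ℕ) : ℝ) - 1 / 2) = y at *
    field_simp
  rw [h]
  generalize (-1) ^ j * (2 / √3) * liouvilleHypergeometric (2 * j - 1) (Real.pi / 6) *
        (gammaHalfRatio ((((2 * j : ℕ) : ℝ) - 1 / 2) / 2) /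
          (√2 * gammaHalfRatio (((2 * j : ℕ) : ℝ) - 1 / 2))) = X
  rw [Complex.ofReal_sub, Complex.ofReal_intCast, Complex.ofReal_mul, Complex.ofReal_mul,
    Complex.ofReal_mul]
  ring

theorem rpow_neg_half_le_gammaHalfRatio {k : ℝ} (hk : 2 ≤ k) :
    k ^ (-(1 / 2) : ℝ) ≤ gammaHalfRatio (k - 1 / 2) := by
  have h := Real.inv_le_Gamma_div_Gamma_add_half_sq (x := k - 1 / 2) (by linarith)
  refine le_of_sq_le_sq ?_ (gammaHalfRatio_pos (by linarith)).le
  refine le_trans ?_ h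
  rw [← Real.rpow_natCast, ← Real.rpow_mul (by linarith)]
  norm_num
  rw [Real.rpow_neg_one]
  exact inv_anti₀ (by linarith) (by linarith)

theorem gammaHalfRatio_le_two_mul_rpow_neg_half {k : ℝ} (hk : 2 ≤ k) :
    gammaHalfRatio (k - 1 / 2) ≤ 2 * k ^ (-(1 / 2) : ℝ) := by
  have h := Real.Gamma_div_Gamma_add_half_sq_le (x := k - 1 / 2) (by linarith)
  refine le_of_sq_le_sq ?_ (by positivity)
  refine le_trans h ?_
  rw [mul_pow, ← Real.rpow_natCast (k ^ _), ← Real.rpow_mul (by linarith)]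
  norm_num
  rw [Real.rpow_neg_one, ← div_eq_mul_inv, inv_eq_one_div,
    div_le_div_iff₀ (by linarith) (by linarith)]
  linarith

theorem mainTheorem2 :
    (∃ E : ℕ → ℂ,
      E =O[atTop ⊓ 𝓟 {k : ℕ | Even k}] (fun k : ℕ => ((k : ℝ))⁻¹) ∧
      ∀ k : ℕ, 0 < k → Even k →
        secondaryTermNegThree k =
          (((3 : ℝ) ^ (1 / 4 : ℝ) * Real.sqrt (2 * Real.pi) : ℝ) : ℂ) *
            chiNegThree.LFunction (1 / 2) *
            ((Real.Gamma ((k : ℝ) - 1 / 2) / Real.Gamma (k : ℝ) : ℝ) : ℂ) *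
            ((residueSign k : ℂ) + E k)) ∧
    secondaryTermNegThree =Θ[atTop ⊓ 𝓟 {k : ℕ | Even k ∧ k % 6 ≠ 4}]
      (fun k : ℕ => (k : ℝ) ^ (-(1 / 2) : ℝ)) ∧
    secondaryTermNegThree =O[atTop ⊓ 𝓟 {k : ℕ | k % 6 = 4}]
      (fun k : ℕ => (k : ℝ) ^ (-(3 / 2) : ℝ)) := by
  set A : ℝ := ‖(((3 : ℝ) ^ (1 / 4 : ℝ) * √(2 * Real.pi) : ℝ) : ℂ) *
      chiNegThree.LFunction (1 / 2)‖ with hA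
  have hA0 : 0 < A := by
    refine norm_pos_iff.2 (mul_ne_zero ?_ LFunction_chiNegThree_half_ne_zero)
    exact Complex.ofReal_ne_zero.2 (by positivity)
  have hnorm : ∀ k : ℕ, 0 < k → Even k → ‖secondaryTermNegThree k‖ =
      A * gammaHalfRatio ((k : ℝ) - 1 / 2) * |residueSign k + secondaryTermError k| := by
    intro k hk0 hk
    have hk1 : (1 : ℝ) ≤ k := by exact_mod_cast hk0
    rw [secondaryTermNegThree_eq hk0 hk, norm_mul, norm_mul _ (gammaHalfRatio _ : ℂ), ← hA,
      Complex.norm_of_nonneg (gammaHalfRatio_pos (by linarith)).le]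
    norm_cast
  have hS : ∀ k : ℕ, k % 6 ≠ 4 → |(residueSign k : ℝ)| = 1 := by
    intro k hk
    unfold residueSign
    split_ifs <;> norm_num
  refine ⟨⟨fun k => (secondaryTermError k : ℂ), ?_, fun k hk0 hk => ?_⟩, ⟨?_, ?_⟩, ?_⟩
  · refine IsBigO.of_bound 20 (eventually_inf_principal.2 ?_)
    filter_upwards [eventually_gt_atTop 0] with k hk0 hk
    rw [Complex.norm_real, Real.norm_eq_abs, norm_inv, Real.norm_natCast, ← div_eq_mul_inv]
    exact abs_secondaryTermError_le hk0 hk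
  · rw [secondaryTermNegThree_eq hk0 hk, gammaHalfRatio, sub_add_cancel]
  · refine IsBigO.of_bound (A * 2 * 2) (eventually_inf_principal.2 ?_)
    -- From `40` on the error `20/k` is at most `1/2`, so `|S(k) + E(k)|` lies between `1/2` and `2`
    -- when `S(k) = ±1`.
    filter_upwards [eventually_ge_atTop 40] with k hk0 hk
    have hk2 : (40 : ℝ) ≤ k := by exact_mod_cast hk0
    have he := abs_secondaryTermError_le (by omega) hk.1
    have he' : (20 : ℝ) / k ≤ 1 / 2 := by rw [div_le_iff₀ (by linarith)]; linarith
    rw [hnorm k (by omega) hk.1, Real.norm_of_nonneg (by positivity)]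
    have h1 : |residueSign k + secondaryTermError k| ≤ 2 := by
      refine (abs_add_le _ _).trans ?_
      rw [hS k hk.2]; linarith
    calc _ ≤ A * (2 * (k : ℝ) ^ (-(1 / 2) : ℝ)) * 2 := by
          gcongr
          exact gammaHalfRatio_le_two_mul_rpow_neg_half (by linarith)
      _ = _ := by ring
  · refine IsBigO.of_bound (2 / A) (eventually_inf_principal.2 ?_)
    filter_upwards [eventually_ge_atTop 40] with k hk0 hk
    have hk2 : (40 : ℝ) ≤ k := by exact_mod_cast hk0
    have he := abs_secondaryTermError_le (by omega) hk.1
    have he' : (20 : ℝ) / k ≤ 1 / 2 := by rw [div_le_iff₀ (by linarith)]; linarith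
    rw [hnorm k (by omega) hk.1, Real.norm_of_nonneg (by positivity)]
    have h1 : 1 / 2 ≤ |residueSign k + secondaryTermError k| := by
      have := abs_sub_abs_le_abs_sub (residueSign k : ℝ) (-secondaryTermError k)
      rw [hS k hk.2, abs_neg, sub_neg_eq_add] at this
      linarith
    have h2 := rpow_neg_half_le_gammaHalfRatio (k := k) (by linarith)
    calc (k : ℝ) ^ (-(1 / 2) : ℝ) = 2 / A * (A * (k : ℝ) ^ (-(1 / 2) : ℝ) * (1 / 2)) := by
          field_simp
      _ ≤ _ := by
          have := (gammaHalfRatio_pos (x := (k : ℝ) - 1 / 2) (by linarith)).le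
          gcongr
  · refine IsBigO.of_bound (A * 2 * 20) (eventually_inf_principal.2 ?_)
    filter_upwards [eventually_ge_atTop 40] with k hk0 hk
    have hk' : k % 6 = 4 := hk
    have hev : Even k := Nat.even_iff.2 (by omega)
    have hk2 : (40 : ℝ) ≤ k := by exact_mod_cast hk0
    have he := abs_secondaryTermError_le (by omega) hev
    -- The main term vanishes here, so the error `20/k` supplies the extra factor `k⁻¹`.
    have hS0 : residueSign k = 0 := by simp [residueSign, hk']
    rw [hnorm k (by omega) hev, Real.norm_of_nonneg (by positivity), hS0, Int.cast_zero, zero_add]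
    have h3 : (k : ℝ) ^ (-(3 / 2) : ℝ) = (k : ℝ) ^ (-(1 / 2) : ℝ) * (k : ℝ)⁻¹ := by
      rw [← Real.rpow_neg_one, ← Real.rpow_add (by linarith)]; norm_num
    calc _ ≤ A * (2 * (k : ℝ) ^ (-(1 / 2) : ℝ)) * (20 / k) := by
          gcongr
          exact gammaHalfRatio_le_two_mul_rpow_neg_half (by linarith)
      _ = _ := by rw [h3]; ring
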